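/- Let $U_r$ ($r\ge 0$) denote the Chebyshev polynomials of the second kind, $U_r(\cos\theta)=\sin((r+1)\theta)/\sin\theta$, and for $k\ge 1$ let $$R_k(x)=\frac{U_{k-1}\left(\frac{1}{2\sqrt{x}}\right)}{\sqrt{x}\,U_k\left(\frac{1}{2\sqrt{x}}\right)},\qquad R^e_k(x)=\tfrac12\bigl(R_k(x)+R_k(-x)\bigr),$$ which are rational functions of $x$. A permutation $\pi$ of $\{1,\dots,n\}$ is even if it has an even number of inversions, it is an involution if $\pi=\pi^{-1}$, and an occurrence in $\pi$ of a pattern $\tau\in\mathfrak S_k$ is a choice of positions $1\le i_1<\dots<i_k\le n$ such that $(\pi_{i_1},\dots,\pi_{i_k})$ is order-isomorphic to $\tau$. Let $I^e_{12\dots k;1}(n)$ be the number of even involutions of $\{1,\dots,n\}$ that have no occurrence of $132$ and exactly one occurrence of $12\dots k$, and let $I^e_{12\dots k;1}(x)=\sum_{n\ge 0}I^e_{12\dots k;1}(n)x^n$. Theorem. For all $k\ge 2$, $$I^e_{12\dots k;1}(x)=x^k\prod_{i=2}^{k}R_i(-x^2)+\sum_{j=0}^{k-2}\frac{x^{k-j}\,R^e_{j+1}(x^2)\prod_{i=j+2}^{k}R_i(-x^2)}{U_{j+2}\left(\frac{1}{2x}\right)},$$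 where the right-hand side, a rational function of $x$, is identified with its Laurent series expansion at $x=0$. -/

import Mathlib

open scoped LaurentSeries PowerSeries

/-! ### Patterns, inversions, involutions -/

/-- The occurrences of the pattern `τ ∈ S_k` in `π ∈ S_n`: the choices of positions
`i_1 < ... < i_k` such that `(π i_1, ..., π i_k)` is order-isomorphic to `τ`. -/
def patternOccurrences {k n : ℕ} (τ : Equiv.Perm (Fin k)) (π : Equiv.Perm (Fin n)) :
    Set (Fin k ↪o Fin n) :=
  {i | ∀ a b : Fin k, π (i a) < π (i b) ↔ τ a < τ b}

/-- `π` avoids `τ`. -/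
def Avoids {k n : ℕ} (π : Equiv.Perm (Fin n)) (τ : Equiv.Perm (Fin k)) : Prop :=
  patternOccurrences τ π = ∅

/-- `π` contains `τ` exactly `r` times. -/
def ContainsExactly {k n : ℕ} (π : Equiv.Perm (Fin n)) (τ : Equiv.Perm (Fin k)) (r : ℕ) : Prop :=
  (patternOccurrences τ π).ncard = r

/-- The pattern `132` (positions and values are numbered from `0`). -/
def pattern132 : Equiv.Perm (Fin 3) := Equiv.swap 1 2

/-- The pattern `12...k`. -/
def increasingPattern (k : ℕ) : Equiv.Perm (Fin k) := 1

/-- The number of inversions of `π`. -/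
noncomputable def inversionCount {n : ℕ} (π : Equiv.Perm (Fin n)) : ℕ :=
  {p : Fin n × Fin n | p.1 < p.2 ∧ π p.2 < π p.1}.ncard

/-- The set of even `132`-avoiding involutions of length `n` that contain `τ` exactly `r` times. -/
def evenInvolutions {k : ℕ} (τ : Equiv.Perm (Fin k)) (r n : ℕ) : Set (Equiv.Perm (Fin n)) :=
  {π | π = π⁻¹ ∧ Even (inversionCount π) ∧ Avoids π pattern132 ∧ ContainsExactly π τ r}

/-- The generating function of the even `132`-avoiding involutions that contain `τ` exactly
`r` times, by length. -/
noncomputable def evenInvolutionsGF {k : ℕ} (τ : Equiv.Perm (Fin k)) (r : ℕ) : ℚ⟦X⟧ :=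
  PowerSeries.mk fun n => ((evenInvolutions τ r n).ncard : ℚ)

/-! ### The rational functions `R_k` -/

/-- `U_r(1/(2x))`, a rational function in `x`, where `U_r` is the Chebyshev polynomial of the
second kind. -/
noncomputable def chebU (r : ℤ) : RatFunc ℚ :=
  Polynomial.aeval (1 / (2 * RatFunc.X) : RatFunc ℚ) (Polynomial.Chebyshev.U ℚ r)

/-- The rational function `f(y)` obtained from `f(x)` by substituting `y` for `x`. -/
noncomputable def ratSubst (f y : RatFunc ℚ) : RatFunc ℚ :=
  RatFunc.eval RatFunc.C y f

lemma eval₂_sq (p : Polynomial ℚ) :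
    Polynomial.eval₂RingHom (RatFunc.C : ℚ →+* RatFunc ℚ) (RatFunc.X ^ 2) p =
      algebraMap (Polynomial ℚ) (RatFunc ℚ) (Polynomial.expand ℚ 2 p) := by
  induction p using Polynomial.induction_on' with
  | add p q hp hq => rw [map_add, hp, hq, map_add, map_add]
  | monomial n a =>
    simp [Polynomial.expand_monomial, RatFunc.algebraMap_monomial, ← pow_mul, mul_comm]

lemma eval₂_sq_injective : Function.Injective
    (Polynomial.eval₂RingHom (RatFunc.C : ℚ →+* RatFunc ℚ) (RatFunc.X ^ 2)) := by
  intro p q h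
  rw [eval₂_sq, eval₂_sq] at h
  exact Polynomial.expand_injective (by norm_num) (RatFunc.algebraMap_injective ℚ h)

/-- The substitution `x ↦ x²` as a homomorphism of fields. -/
noncomputable def sqSubstHom : RatFunc ℚ →+* RatFunc ℚ :=
  RatFunc.liftRingHom _ (nonZeroDivisors_le_comap_nonZeroDivisors_of_injective _
    eval₂_sq_injective)

lemma sqSubstHom_apply (f : RatFunc ℚ) : sqSubstHom f = ratSubst f (RatFunc.X ^ 2) := by
  rw [sqSubstHom, RatFunc.liftRingHom_apply]; rfl

/-- Auxiliary polynomials `q_r` with `q_r(x²) = x^r U_r(1/(2x))`. -/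
noncomputable def chebAux : ℕ → Polynomial ℚ
  | 0 => 1
  | 1 => 1
  | n + 2 => chebAux (n + 1) - Polynomial.X * chebAux n

lemma chebAux_coeff_zero : ∀ n, (chebAux n).coeff 0 = 1
  | 0 => by simp [chebAux]
  | 1 => by simp [chebAux]
  | n + 2 => by simp [chebAux, chebAux_coeff_zero (n + 1)]

lemma chebAux_ne_zero (n : ℕ) : chebAux n ≠ 0 := fun h => by
  have := chebAux_coeff_zero n
  simp [h] at this

lemma sqSubstHom_chebAux : ∀ n : ℕ,
    sqSubstHom (algebraMap _ _ (chebAux n)) = RatFunc.X ^ n * chebU n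
  | 0 => by simp [chebAux, chebU]
  | 1 => by
    have := RatFunc.X_ne_zero (K := ℚ)
    simp only [chebAux, chebU, Nat.cast_one, Polynomial.Chebyshev.U_one, map_mul, map_one,
      map_ofNat, Polynomial.aeval_X]
    field_simp
  | n + 2 => by
    have hx := RatFunc.X_ne_zero (K := ℚ)
    have h1 := sqSubstHom_chebAux n
    have h2 := sqSubstHom_chebAux (n + 1)
    have h3 : sqSubstHom RatFunc.X = RatFunc.X ^ 2 := by
      rw [sqSubstHom_apply, ratSubst, RatFunc.eval_X]
    have h4 : chebU ((n : ℤ) + 2) = 1 / RatFunc.X * chebU ((n : ℤ) + 1) - chebU n := by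
      simp only [chebU, Polynomial.Chebyshev.U_add_two, map_sub, map_mul,
        map_ofNat, Polynomial.aeval_X]
      congr 2
      field_simp
    rw [chebAux, map_sub, map_mul, map_sub, map_mul, RatFunc.algebraMap_X, h1, h2, h3]
    push_cast
    rw [h4]
    field_simp
    ring

/-- There is exactly one rational function `R_k(x)` that satisfies
`R_k(x) = U_{k-1}(1/(2√x)) / (√x U_k(1/(2√x)))`, read with `x²` in place of `x`. -/
theorem existsUnique_chebR (k : ℕ) : ∃! f : RatFunc ℚ,
    ratSubst f (RatFunc.X ^ 2) = chebU ((k : ℤ) - 1) / (RatFunc.X * chebU k) := by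
  have hx := RatFunc.X_ne_zero (K := ℚ)
  refine existsUnique_of_exists_of_unique ?_ ?_
  · cases k with
    | zero => exact ⟨0, by simp [ratSubst, chebU]⟩
    | succ n =>
      refine ⟨algebraMap _ _ (chebAux n) / algebraMap _ _ (chebAux (n + 1)), ?_⟩
      rw [← sqSubstHom_apply, map_div₀, sqSubstHom_chebAux, sqSubstHom_chebAux, pow_succ,
        mul_assoc, mul_div_mul_left _ _ (pow_ne_zero n hx)]
      push_cast
      rw [add_sub_cancel_right]
  · intro f g hf hg
    rw [← sqSubstHom_apply] at hf hg
    exact sqSubstHom.injective (hf.trans hg.symm)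

/-- `R_k(x) = U_{k-1}(1/(2√x)) / (√x U_k(1/(2√x)))`, as a rational function in `x`. -/
noncomputable def chebR (k : ℕ) : RatFunc ℚ := (existsUnique_chebR k).choose

theorem chebR_spec (k : ℕ) :
    ratSubst (chebR k) (RatFunc.X ^ 2) = chebU ((k : ℤ) - 1) / (RatFunc.X * chebU k) :=
  (existsUnique_chebR k).choose_spec.1

/-- `R^e_k(x) = (R_k(x) + R_k(-x)) / 2`. -/
noncomputable def chebREven (k : ℕ) : RatFunc ℚ :=
  (1 / 2) * (chebR k + ratSubst (chebR k) (-RatFunc.X))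

/-! ### Permutations of an initial segment of the natural numbers -/

/-! Even permutations are extracted by averaging the generating functions `W_k` of all involutions
in question, weighted by `ε ^ inversions`, over `ε = 1` and `ε = -1` (`evenInvolutionsGF_eq`).

A nonempty 132-avoiding involution is either `q.snoc` with `q` such an involution, or `wrap p q`:
the skew sum of `p.snoc`, an involution `q` and the inverse of `p.snoc`
(`Av132.exists_snoc_or_wrap`). In the second case the sign depends only on the size of `p` and the
sign of `q` (`pow_invNum_wrap`). Occurrences of 12...(k+1) inside `p.snoc` are counted twice, so a
single occurrence must lie in `q`, and `p` avoids 12...k (`occ_wrap`). Hence `W_{k+1} = x W_k + ε x²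
A_k W_{k+1}`, where `A_k` counts 132- and 12...k-avoiders with weight `ε ^ size * x ^ (2 * size)`.

Splitting avoiders at the maximum gives `A_{k+1} = 1 + ε x² A_k A_{k+1}` with `A_0 = 0`. The
Chebyshev recurrence gives `R_k(ε x²)` the same recursion, so `A_k = R_k(ε x²)` and `W_k = x^k
∏_{i=2}^k R_i(ε x²)`. For `ε = 1` this telescopes to `1 / U_k(1/(2x))`, and an induction on `k`
rewrites the average of the two products as the stated sum (`half_signedW_add`). -/

/-- A permutation of `{0, ..., size - 1}`, extended to `ℕ` by the identity. -/
@[ext] structure SegPerm where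
  size : ℕ
  perm : Equiv.Perm ℕ
  fix : ∀ x, size ≤ x → perm x = x

namespace SegPerm

lemma lt_iff (p : SegPerm) (x : ℕ) : p.perm x < p.size ↔ x < p.size := by
  constructor
  · intro h
    by_contra hx
    rw [p.fix x (by omega)] at h
    exact hx h
  · intro h
    by_contra hx
    have := p.perm.injective (p.fix (p.perm x) (by omega))
    omega

lemma ext_of_lt {p q : SegPerm} (hs : p.size = q.size)
    (h : ∀ x < p.size, p.perm x = q.perm x) : p = q := by
  refine SegPerm.ext hs (Equiv.ext fun x => ?_)
  by_cases hx : x < p.size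
  · exact h x hx
  · rw [p.fix x (by omega), q.fix x (by omega)]

/-- The permutation of size `n` with given mutually inverse values. -/
def mk' (n : ℕ) (f g : ℕ → ℕ) (hf : ∀ x < n, f x < n ∧ g (f x) = x)
    (hg : ∀ x < n, g x < n ∧ f (g x) = x) : SegPerm where
  size := n
  perm :=
    { toFun := fun x => if x < n then f x else x
      invFun := fun x => if x < n then g x else x
      left_inv := fun x => by
        by_cases hx : x < n
        · simp [hx, hf x hx]
        · simp [hx]
      right_inv := fun x => by
        by_cases hx : x < n
        · simp [hx, hg x hx]
        · simp [hx] }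
  fix := fun x hx => by simp [hx]

lemma mk'_perm_apply {n : ℕ} {f g : ℕ → ℕ} (hf hg) {x : ℕ} (hx : x < n) :
    (mk' n f g hf hg).perm x = f x := by
  simp [mk', hx]

/-- The empty permutation. -/
def empty : SegPerm := ⟨0, 1, fun _ _ => rfl⟩

/-- The inverse permutation. -/
def inv (p : SegPerm) : SegPerm where
  size := p.size
  perm := p.perm.symm
  fix := fun x hx => by rw [Equiv.symm_apply_eq, p.fix x hx]

@[simp] lemma inv_size (p : SegPerm) : p.inv.size = p.size := rfl

@[simp] lemma inv_perm (p : SegPerm) : p.inv.perm = p.perm.symm := rfl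

@[simp] lemma inv_inv (p : SegPerm) : p.inv.inv = p := by
  ext <;> simp

/-- Append a new maximum at the end. -/
def snoc (p : SegPerm) : SegPerm where
  size := p.size + 1
  perm := p.perm
  fix := fun x hx => p.fix x (by omega)

@[simp] lemma snoc_size (p : SegPerm) : p.snoc.size = p.size + 1 := rfl

@[simp] lemma snoc_perm (p : SegPerm) : p.snoc.perm = p.perm := rfl

lemma snoc_inv (p : SegPerm) : p.snoc.inv = p.inv.snoc := rfl

lemma snoc_injective : Function.Injective snoc := by
  intro p q h
  have h1 := congrArg size h
  have h2 := congrArg perm h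
  exact SegPerm.ext (by simpa using h1) (by simpa using h2)

/-- The skew sum: `p` shifted above `q`, followed by `q`. -/
def skew (p q : SegPerm) : SegPerm :=
  mk' (p.size + q.size)
    (fun x => if x < p.size then q.size + p.perm x else q.perm (x - p.size))
    (fun y => if y < q.size then p.size + q.perm.symm y else p.perm.symm (y - q.size))
    (fun x hx => by
      by_cases h : x < p.size
      · have := (p.lt_iff x).2 h
        simp [h]
        omega
      · have h1 : x - p.size < q.size := by omega
        have := (q.lt_iff _).2 h1
        simp [h, this]
        omega)
    (fun y hy => by
      by_cases h : y < q.size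
      · have := (q.inv.lt_iff y).2 h
        simp only [inv_size, inv_perm] at this
        simp [h]
        omega
      · have h1 : y - q.size < p.size := by omega
        have := (p.inv.lt_iff _).2 h1
        simp only [inv_size, inv_perm] at this
        simp [h, this]
        omega)

@[simp] lemma skew_size (p q : SegPerm) : (skew p q).size = p.size + q.size := rfl

lemma skew_left (p q : SegPerm) {x : ℕ} (hx : x < p.size) :
    (skew p q).perm x = q.size + p.perm x := by
  rw [skew, mk'_perm_apply _ _ (by omega), if_pos hx]

lemma skew_right (p q : SegPerm) {x : ℕ} (hx : x < q.size) :
    (skew p q).perm (p.size + x) = q.perm x := by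
  rw [skew, mk'_perm_apply _ _ (by omega), if_neg (by omega), Nat.add_sub_cancel_left]

lemma skew_right' (p q : SegPerm) {x : ℕ} (hx : p.size ≤ x) (hx' : x < p.size + q.size) :
    (skew p q).perm x = q.perm (x - p.size) := by
  rw [← skew_right p q (by omega), Nat.add_sub_cancel' hx]

lemma skew_empty (p : SegPerm) : skew p empty = p :=
  ext_of_lt rfl fun x hx => by
    rw [skew_left p empty (by simpa [empty] using hx)]
    simp [empty]

lemma skew_assoc (p q r : SegPerm) : skew (skew p q) r = skew p (skew q r) := by
  refine ext_of_lt (by simp [add_assoc]) fun x hx => ?_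
  simp only [skew_size] at hx
  rcases lt_or_ge x p.size with h | h
  · rw [skew_left _ _ (by simp; omega), skew_left _ _ h, skew_left _ _ h]
    simp; omega
  · rcases lt_or_ge x (p.size + q.size) with h' | h'
    · rw [skew_left _ _ (by simp; omega), skew_right' _ _ h h',
        skew_right' _ _ h (by simp; omega), skew_left _ _ (by omega)]
    · rw [skew_right' _ _ (by simp; omega) (by simp; omega),
        skew_right' _ _ h (by simp; omega), skew_right' _ _ (by omega) (by omega)]
      congr 1
      simp; omega

lemma skew_inv (p q : SegPerm) : (skew p q).inv = skew q.inv p.inv := by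
  refine ext_of_lt (by simp [add_comm]) fun x hx => ?_
  simp only [inv_size, skew_size] at hx
  rw [inv_perm, Equiv.symm_apply_eq]
  symm
  rcases lt_or_ge x q.size with h | h
  · have h1 := (q.inv.lt_iff x).2 h
    rw [skew_left q.inv _ (by simpa using h), inv_size, skew_right _ _ (by simpa using h1)]
    simp
  · have h1 := (p.inv.lt_iff (x - q.size)).2 (by simp; omega)
    rw [skew_right' q.inv _ (by simpa using h) (by simp; omega), inv_size,
      skew_left _ _ (by simpa using h1)]
    simp; omega

lemma skew_inj {p q p' q' : SegPerm} (hs : p.size = p'.size) (h : skew p q = skew p' q') :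
    p = p' ∧ q = q' := by
  have h1 : q.size = q'.size := by
    have := congrArg size h
    simp at this; omega
  constructor
  · refine ext_of_lt hs fun x hx => ?_
    have := skew_left p q hx
    rw [h, skew_left p' q' (by omega)] at this
    omega
  · refine ext_of_lt h1 fun x hx => ?_
    have := skew_right p q hx
    rwa [h, hs, skew_right p' q' (by omega), eq_comm] at this

/-- By pigeonhole, each of the first `a` values exceeds `b` distinct later ones, hence is at least
`b`; dually each later value is below `b`. So both blocks are permutations after shifting. -/
lemma exists_skew (p : SegPerm) (a b : ℕ) (hs : p.size = a + b)
    (h : ∀ x < a, ∀ y, a ≤ y → y < p.size → p.perm y < p.perm x) :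
    ∃ q r : SegPerm, q.size = a ∧ r.size = b ∧ p = skew q r := by
  have h1 : ∀ x < a, b ≤ p.perm x := fun x hx => by
    have : ((Finset.Ico a (a + b)).image p.perm).card ≤ (Finset.range (p.perm x)).card := by
      refine Finset.card_le_card fun y hy => ?_
      obtain ⟨z, hz, rfl⟩ := Finset.mem_image.1 hy
      rw [Finset.mem_Ico] at hz
      exact Finset.mem_range.2 (h x hx z hz.1 (by omega))
    rw [Finset.card_image_of_injective _ p.perm.injective] at this
    simpa using this
  have h2 : ∀ y, a ≤ y → y < a + b → p.perm y < b := fun y hy hy' => by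
    have : ((Finset.range a).image p.perm).card ≤
        (Finset.Ico (p.perm y + 1) (a + b)).card := by
      refine Finset.card_le_card fun x hx => ?_
      obtain ⟨z, hz, rfl⟩ := Finset.mem_image.1 hx
      rw [Finset.mem_range] at hz
      have := h z hz y hy (by omega)
      have := (p.lt_iff z).2 (by omega)
      rw [Finset.mem_Ico]
      omega
    rw [Finset.card_image_of_injective _ p.perm.injective] at this
    have h3 := (p.lt_iff y).2 (by omega)
    simp at this
    omega
  have h3 : ∀ y < a, p.perm.symm (b + y) < a := fun y hy => by
    by_contra hc
    have h4 := (p.inv.lt_iff (b + y)).2 (by simp; omega)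
    simp only [inv_size, inv_perm] at h4
    have := h2 _ (not_lt.1 hc) (by omega)
    simp at this
  have h5 : ∀ y < b, a ≤ p.perm.symm y ∧ p.perm.symm y < a + b := fun y hy => by
    refine ⟨?_, ?_⟩
    · by_contra hc
      have := h1 _ (not_le.1 hc)
      simp at this
      omega
    · have h4 := (p.inv.lt_iff y).2 (by simp; omega)
      simpa [hs] using h4
  refine ⟨mk' a (fun x => p.perm x - b) (fun y => p.perm.symm (b + y)) (fun x hx => ?_)
    (fun y hy => ?_), mk' b (fun x => p.perm (a + x)) (fun y => p.perm.symm y - a)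
    (fun x hx => ?_) (fun y hy => ?_), rfl, rfl, ext_of_lt (by simpa [mk'] using hs) fun x hx => ?_⟩
  · have h6 := h1 x hx
    have := (p.lt_iff x).2 (by omega)
    exact ⟨by omega, by rw [Nat.add_sub_cancel' h6]; simp⟩
  · exact ⟨h3 y hy, by simp⟩
  · exact ⟨h2 _ (by omega) (by omega), by simp⟩
  · have := h5 y hy
    exact ⟨by omega, by rw [Nat.add_sub_cancel' this.1]; simp⟩
  · rcases lt_or_ge x a with hxa | hxa
    · rw [skew_left _ _ (by simpa [mk'] using hxa), mk'_perm_apply _ _ hxa]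
      have := h1 x hxa
      simp [mk']; omega
    · rw [skew_right' _ _ (by simpa [mk'] using hxa) (by simp [mk']; omega),
        mk'_perm_apply _ _ (by simp [mk']; omega)]
      simp [mk', hxa]

lemma exists_snoc (p : SegPerm) (a : ℕ) (hs : p.size = a + 1) (h : p.perm a = a) :
    ∃ q : SegPerm, q.size = a ∧ p = q.snoc :=
  ⟨⟨a, p.perm, fun x hx => by
    rcases hx.eq_or_lt with rfl | hx
    · exact h
    · exact p.fix x (by omega)⟩, rfl, SegPerm.ext hs rfl⟩

/-! ### Avoidance of `132` -/

/-- `p` has no occurrence of `132`. -/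
def Av132 (p : SegPerm) : Prop :=
  ∀ x y z, x < y → y < z → z < p.size → p.perm x < p.perm z → ¬ p.perm z < p.perm y

lemma av132_empty : empty.Av132 := by
  intro x y z _ _ hz
  simp [empty] at hz

lemma av132_snoc (p : SegPerm) : p.snoc.Av132 ↔ p.Av132 := by
  refine ⟨fun h x y z hx hy hz => h x y z hx hy (by simp; omega), fun h x y z hx hy hz => ?_⟩
  simp only [snoc_size, snoc_perm] at *
  rcases (Nat.lt_succ_iff.1 hz).eq_or_lt with rfl | hz'
  · have := p.fix _ le_rfl
    have := (p.lt_iff y).2 hy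
    omega
  · exact h x y z hx hy hz'

lemma skew_left_lt_right (p q : SegPerm) {x y : ℕ} (hx : x < p.size) (hy : p.size ≤ y)
    (hy' : y < p.size + q.size) : (skew p q).perm y < (skew p q).perm x := by
  rw [skew_left _ _ hx, skew_right' _ _ hy hy']
  have := (q.lt_iff (y - p.size)).2 (by omega)
  omega

lemma av132_skew (p q : SegPerm) : (skew p q).Av132 ↔ p.Av132 ∧ q.Av132 := by
  refine ⟨fun h => ⟨fun x y z hx hy hz => ?_, fun x y z hx hy hz => ?_⟩,
    fun ⟨h, h'⟩ x y z hx hy hz => ?_⟩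
  · have := h x y z hx hy (by simp; omega)
    simpa [skew_left p q hz, skew_left p q (hy.trans hz),
      skew_left p q (hx.trans (hy.trans hz))] using this
  · have := h (p.size + x) (p.size + y) (p.size + z) (by omega) (by omega) (by simp; omega)
    simpa [skew_right p q hz, skew_right p q (hy.trans hz),
      skew_right p q (hx.trans (hy.trans hz))] using this
  · simp only [skew_size] at hz
    rcases lt_or_ge z p.size with hzp | hzp
    · simpa [skew_left p q hzp, skew_left p q (hy.trans hzp),
        skew_left p q (hx.trans (hy.trans hzp))] using h x y z hx hy hzp
    · rcases lt_or_ge x p.size with hxp | hxp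
      · have := skew_left_lt_right p q hxp hzp hz
        omega
      · rw [skew_right' p q hzp hz, skew_right' p q hxp (by omega),
          skew_right' p q (by omega : p.size ≤ y) (by omega)]
        exact h' _ _ _ (by omega) (by omega) (by omega)

lemma av132_inv {p : SegPerm} (h : p.Av132) : p.inv.Av132 := by
  intro x y z hx hy hz h1 h2
  simp only [inv_size, inv_perm] at *
  have hy' := (p.inv.lt_iff y).2 (by simp; omega)
  exact h _ _ _ h1 h2 hy' (by simpa using hx) (by simpa using hy)

/-- A nonempty `132`-avoiding permutation splits at its maximum. -/
lemma Av132.exists_skew_snoc {p : SegPerm} (h : p.Av132) (hs : p.size ≠ 0) :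
    ∃ q r : SegPerm, p = skew q.snoc r := by
  obtain ⟨n, hn⟩ := Nat.exists_eq_succ_of_ne_zero hs
  have hm := (p.inv.lt_iff n).2 (by simp; omega)
  simp only [inv_size, inv_perm] at hm
  set m := p.perm.symm n with hmdef
  have hpm : p.perm m = n := by simp [hmdef]
  -- Cut just after the position `m` of the maximum: `x` before `m` and `y` after it with `p.perm x
  -- < p.perm y` would make `x, m, y` a 132.
  obtain ⟨q, r, hq, hr, rfl⟩ := p.exists_skew (m + 1) (n - m) (by omega) fun x hx y hy hys => by
    have hyn : p.perm y < n := by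
      have := (p.lt_iff y).2 hys
      have : p.perm y ≠ p.perm m := fun he => by
        have := p.perm.injective he
        omega
      omega
    rcases (Nat.lt_succ_iff.1 hx).eq_or_lt with rfl | hx
    · omega
    · by_contra hc
      have : p.perm x ≠ p.perm y := fun he => by
        have := p.perm.injective he
        omega
      exact h x m y hx (by omega) hys (by omega) (by omega)
  obtain ⟨q', -, rfl⟩ := q.exists_snoc m hq (by
    rw [skew_left _ _ (by omega)] at hpm
    simp at hn
    omega)
  exact ⟨q', r, rfl⟩

lemma skew_snoc_max (p q : SegPerm) :
    (skew p.snoc q).perm p.size + 1 = (skew p.snoc q).size := by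
  rw [skew_left _ _ (by simp)]
  simp [p.fix]
  omega

lemma skew_snoc_inj {p q p' q' : SegPerm} (h : skew p.snoc q = skew p'.snoc q') :
    p = p' ∧ q = q' := by
  have h1 := skew_snoc_max p q
  have h2 := skew_snoc_max p' q'
  rw [h, ← h2] at h1
  have h3 : p.size = p'.size := (skew p'.snoc q').perm.injective (by omega)
  obtain ⟨h4, h5⟩ := skew_inj (by simpa using h3) h
  exact ⟨snoc_injective h4, h5⟩

/-! ### Involutions -/

/-- The involution built from a permutation and a shorter involution. -/
def wrap (p q : SegPerm) : SegPerm := skew p.snoc (skew q p.inv.snoc)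

lemma wrap_size (p q : SegPerm) : (wrap p q).size = 2 * p.size + 2 + q.size := by
  simp [wrap]; omega

lemma wrap_inj {p q p' q' : SegPerm} (h : wrap p q = wrap p' q') : p = p' ∧ q = q' := by
  obtain ⟨rfl, h2⟩ := skew_snoc_inj h
  have := congrArg size h2
  exact ⟨rfl, (skew_inj (by simpa using this) h2).1⟩

/-- The maximum of `wrap p q` is at position `p.size`, never the last one. This makes the two cases
of the decomposition disjoint. -/
lemma wrap_ne_snoc (p q r : SegPerm) : wrap p q ≠ r.snoc := fun h => by
  have h1 := skew_snoc_max p (skew q p.inv.snoc)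
  have h2 := r.fix r.size le_rfl
  have h3 := wrap_size p q
  rw [← wrap, h] at h1
  rw [h] at h3
  simp only [snoc_size, snoc_perm] at h1 h3
  have := r.perm.injective (h2.trans (by omega : r.size = r.perm p.size))
  omega

/-- Inversion reverses the blocks of a skew sum and inverts each, so the two outer blocks are
exchanged and only `q` changes. -/
lemma wrap_inv (p q : SegPerm) : (wrap p q).inv = wrap p q.inv := by
  rw [wrap, skew_inv, skew_inv, snoc_inv, snoc_inv, inv_inv, skew_assoc, wrap]

lemma wrap_involutive_iff (p q : SegPerm) : (wrap p q).inv = wrap p q ↔ q.inv = q := by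
  rw [wrap_inv]
  exact ⟨fun h => (wrap_inj h).2, fun h => by rw [h]⟩

lemma snoc_involutive_iff (p : SegPerm) : p.snoc.inv = p.snoc ↔ p.inv = p := by
  rw [snoc_inv]
  exact snoc_injective.eq_iff

/-- A nonempty `132`-avoiding involution either fixes its maximum or is wrapped around a
shorter one. -/
lemma Av132.exists_snoc_or_wrap {p : SegPerm} (h : p.Av132) (hs : p.size ≠ 0)
    (hi : p.inv = p) : (∃ q : SegPerm, p = q.snoc) ∨ ∃ q r, p = wrap q r := by
  obtain ⟨q, t, rfl⟩ := h.exists_skew_snoc hs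
  rcases Nat.eq_zero_or_pos t.size with ht | ht
  · left
    refine ⟨q, ?_⟩
    rw [show t = empty from ext_of_lt ht fun x hx => by omega, skew_empty]
  right
  set P := skew q.snoc t with hP
  have hPP : ∀ x, P.perm (P.perm x) = x := fun x => by
    have : P.perm = P.perm.symm := (congrArg perm hi).symm
    nth_rw 1 [this]
    simp
  have hPs : P.size = q.size + 1 + t.size := rfl
  have hL : ∀ x ≤ q.size, t.size ≤ P.perm x := fun x hx => by
    rw [hP, skew_left _ _ (by simp; omega)]
    omega
  have hR : ∀ x, q.size < x → x < P.size → P.perm x < t.size := fun x hx hx' => by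
    rw [hP, skew_right' _ _ (by simp; omega) (by simp; omega), t.lt_iff]
    simp; omega
  -- The maximum stands at position `q.size`, so by involutivity the last position, which lies in
  -- the block `t`, carries the value `q.size`.
  have hle : q.size + 1 ≤ t.size := by
    have h1 := skew_snoc_max q t
    rw [← hP] at h1
    have h2 := hPP q.size
    have := hR (P.perm q.size) (by omega) (by omega)
    omega
  -- The first `q.size + 1` positions carry values at least `t.size`. Since `P` is an involution,
  -- exactly the last `q.size + 1` positions carry values at most `q.size`, which splits `t`.
  obtain ⟨u, v, hu, hv, rfl⟩ := t.exists_skew (t.size - (q.size + 1)) (q.size + 1) (by omega)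
    fun x hx y hy hys => by
      rw [← skew_right q.snoc t (by omega : x < t.size), ← skew_right q.snoc t hys, ← hP,
        snoc_size]
      have h1 : P.perm (q.size + 1 + y) ≤ q.size := by
        by_contra hc
        have h2 := hR (P.perm (q.size + 1 + y)) (by omega) (by rw [P.lt_iff]; omega)
        rw [hPP] at h2
        omega
      have h2 : q.size < P.perm (q.size + 1 + x) := by
        by_contra hc
        have h2 := hL (P.perm (q.size + 1 + x)) (by omega)
        rw [hPP] at h2
        omega
      omega
  refine ⟨q, u, ?_⟩
  -- Comparing the first blocks of `P.inv` and `P` gives `v.inv = q.snoc`.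
  rw [hP, skew_inv, skew_inv, skew_assoc] at hi
  rw [hP, wrap, ← snoc_inv, ← (skew_inj (by simp [hv]) hi).1, inv_inv]

end SegPerm

namespace SegPerm

/-! ### Inversions -/

/-- The number of inversions. -/
def invNum (p : SegPerm) : ℕ :=
  ∑ x ∈ Finset.range p.size, ∑ y ∈ Finset.range p.size,
    if x < y ∧ p.perm y < p.perm x then 1 else 0

lemma invNum_snoc (p : SegPerm) : p.snoc.invNum = p.invNum := by
  have h : ∀ x ∈ Finset.range p.size, ∑ y ∈ Finset.range (p.size + 1),
      (if x < y ∧ p.perm y < p.perm x then 1 else 0) =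
      ∑ y ∈ Finset.range p.size, if x < y ∧ p.perm y < p.perm x then 1 else 0 := by
    intro x hx
    have h1 := (p.lt_iff x).2 (Finset.mem_range.1 hx)
    rw [Finset.sum_range_succ, p.fix _ le_rfl, if_neg (by omega), add_zero]
  rw [invNum, snoc_size, snoc_perm, Finset.sum_range_succ, Finset.sum_congr rfl h, invNum,
    add_eq_left, Finset.sum_eq_zero]
  intro y hy
  rw [Finset.mem_range] at hy
  rw [if_neg (by omega)]

lemma invNum_inv (p : SegPerm) : p.inv.invNum = p.invNum := by
  have h : ∀ f : ℕ → ℕ, ∑ x ∈ Finset.range p.size, f x =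
      ∑ x ∈ Finset.range p.size, f (p.perm x) := fun f => by
    refine (Finset.sum_equiv p.perm (fun x => ?_) fun x _ => rfl).symm
    rw [Finset.mem_range, Finset.mem_range, p.lt_iff]
  rw [invNum, inv_size, h, Finset.sum_congr rfl fun x _ => h _, Finset.sum_comm]
  refine Finset.sum_congr rfl fun x _ => Finset.sum_congr rfl fun y _ => ?_
  simp [and_comm]

lemma invNum_skew (p q : SegPerm) :
    (skew p q).invNum = p.invNum + q.invNum + p.size * q.size := by
  have h1 : ∀ x ∈ Finset.range p.size, (∑ y ∈ Finset.range (p.size + q.size),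
      if x < y ∧ (skew p q).perm y < (skew p q).perm x then 1 else 0) =
      (∑ y ∈ Finset.range p.size, if x < y ∧ p.perm y < p.perm x then 1 else 0) + q.size := by
    intro x hx
    rw [Finset.mem_range] at hx
    rw [Finset.sum_range_add]
    congr 1
    · refine Finset.sum_congr rfl fun y hy => ?_
      rw [Finset.mem_range] at hy
      simp [skew_left p q hx, skew_left p q hy]
    · rw [Finset.sum_congr rfl (g := fun _ => 1), Finset.sum_const, Finset.card_range,
        smul_eq_mul, mul_one]
      intro y hy
      rw [Finset.mem_range] at hy
      rw [if_pos ⟨by omega, skew_left_lt_right p q hx (by omega) (by omega)⟩]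
  have h2 : ∀ x ∈ Finset.range q.size, (∑ y ∈ Finset.range (p.size + q.size),
      if p.size + x < y ∧ (skew p q).perm y < (skew p q).perm (p.size + x) then 1 else 0) =
      ∑ y ∈ Finset.range q.size, if x < y ∧ q.perm y < q.perm x then 1 else 0 := by
    intro x hx
    rw [Finset.mem_range] at hx
    rw [Finset.sum_range_add, Finset.sum_eq_zero, zero_add]
    · refine Finset.sum_congr rfl fun y hy => ?_
      rw [Finset.mem_range] at hy
      simp [skew_right p q hx, skew_right p q hy]
    · intro y hy
      rw [Finset.mem_range] at hy
      rw [if_neg (by omega)]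
  rw [invNum, skew_size, Finset.sum_range_add, Finset.sum_congr rfl h1, Finset.sum_congr rfl h2,
    Finset.sum_add_distrib, Finset.sum_const, Finset.card_range, smul_eq_mul, invNum, invNum]
  ring

/-- The inversions inside the outer blocks and those between an outer block and `q` come in equal
pairs. What remains is `(p.size + 1) ^ 2`, of the same parity as `p.size + 1`, and the inversions of
`q`. -/
lemma pow_invNum_wrap {R : Type*} [CommRing R] {ε : R} (hε : ε ^ 2 = 1) (p q : SegPerm) :
    ε ^ (wrap p q).invNum = ε ^ (p.size + 1) * ε ^ q.invNum := by
  have h : (wrap p q).invNum =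
      2 * (p.invNum + (p.size + 1) * q.size) + (p.size + 1) * (p.size + 1) + q.invNum := by
    rw [wrap, invNum_skew, invNum_skew, invNum_snoc, invNum_snoc, invNum_inv]
    simp only [skew_size, snoc_size, inv_size]
    ring
  rw [h, pow_add, pow_add, pow_mul, hε, one_pow, one_mul]
  congr 1
  have h2 : (p.size + 1) * (p.size + 1) = p.size * (p.size + 1) + (p.size + 1) := by ring
  obtain ⟨c, hc⟩ := (Nat.even_mul_succ_self p.size)
  rw [h2, hc, ← two_mul, pow_add, pow_mul, hε, one_pow, one_mul]

/-! ### Increasing subsequences -/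

open Classical in
/-- The sets of positions of the occurrences of `12...k`. -/
noncomputable def incSets (k : ℕ) (p : SegPerm) : Finset (Finset ℕ) :=
  ((Finset.range p.size).powersetCard k).filter fun s => StrictMonoOn p.perm s

/-- The number of occurrences of `12...k`. -/
noncomputable def occ (k : ℕ) (p : SegPerm) : ℕ := (incSets k p).card

lemma mem_incSets {k : ℕ} {p : SegPerm} {s : Finset ℕ} :
    s ∈ incSets k p ↔ ((∀ x ∈ s, x < p.size) ∧ s.card = k) ∧ StrictMonoOn p.perm s := by
  simp [incSets, Finset.mem_powersetCard, Finset.subset_iff]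

lemma occ_zero (p : SegPerm) : occ 0 p = 1 := by
  rw [occ, Finset.card_eq_one]
  refine ⟨∅, Finset.ext fun s => ?_⟩
  rw [mem_incSets, Finset.mem_singleton]
  constructor
  · rintro ⟨⟨-, h⟩, -⟩
    exact Finset.card_eq_zero.1 h
  · rintro rfl
    simp [StrictMonoOn]

lemma occ_one (p : SegPerm) : occ 1 p = p.size := by
  rw [occ, incSets, Finset.filter_true_of_mem, Finset.card_powersetCard, Finset.card_range,
    Nat.choose_one_right]
  intro s hs
  obtain ⟨a, rfl⟩ := Finset.card_eq_one.1 (Finset.mem_powersetCard.1 hs).2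
  simp

lemma occ_empty (k : ℕ) : occ (k + 1) empty = 0 := by
  rw [occ, incSets, Finset.powersetCard_eq_empty.2 (by simp [empty])]
  simp

/-- An occurrence either misses the last position or consists of it and an arbitrary occurrence of
12...k in `p`. -/
lemma occ_snoc (k : ℕ) (p : SegPerm) : occ (k + 1) p.snoc = occ (k + 1) p + occ k p := by
  have h : incSets (k + 1) p.snoc =
      incSets (k + 1) p ∪ (incSets k p).image (insert p.size) := by
    ext s
    simp only [Finset.mem_union, Finset.mem_image, mem_incSets, snoc_size, snoc_perm]
    constructor
    · rintro ⟨⟨h1, h2⟩, h3⟩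
      by_cases hs : p.size ∈ s
      · right
        refine ⟨s.erase p.size, ⟨⟨fun x hx => ?_, ?_⟩, ?_⟩, Finset.insert_erase hs⟩
        · rw [Finset.mem_erase] at hx
          have := h1 x hx.2
          omega
        · rw [Finset.card_erase_of_mem hs, h2, Nat.add_sub_cancel]
        · exact h3.mono (by simp)
      · left
        refine ⟨⟨fun x hx => ?_, h2⟩, h3⟩
        have := h1 x hx
        have : x ≠ p.size := fun h => hs (h ▸ hx)
        omega
    · rintro (⟨⟨h1, h2⟩, h3⟩ | ⟨t, ⟨⟨h1, h2⟩, h3⟩, rfl⟩)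
      · exact ⟨⟨fun x hx => (h1 x hx).trans (Nat.lt_succ_self _), h2⟩, h3⟩
      · refine ⟨⟨fun x hx => ?_, ?_⟩, fun x hx y hy hxy => ?_⟩
        · rcases Finset.mem_insert.1 hx with rfl | hx
          · omega
          · exact (h1 x hx).trans (Nat.lt_succ_self _)
        · rw [Finset.card_insert_of_notMem fun h => (h1 _ h).ne rfl, h2]
        · rcases Finset.mem_insert.1 hx with rfl | hx <;>
            rcases Finset.mem_insert.1 hy with rfl | hy
          · omega
          · have := h1 y hy
            omega
          · rw [p.fix _ le_rfl, p.lt_iff]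
            exact hxy
          · exact h3 hx hy hxy
  rw [occ, h, Finset.card_union_of_disjoint, Finset.card_image_of_injOn, occ, occ]
  · intro s hs t ht hst
    have hs' := (mem_incSets.1 hs).1.1
    have ht' := (mem_incSets.1 ht).1.1
    rw [← Finset.erase_insert fun h => (hs' _ h).ne rfl,
      ← Finset.erase_insert fun h => (ht' _ h).ne rfl]
    exact congrArg (fun s => s.erase p.size) hst
  · rw [Finset.disjoint_left]
    intro s hs hs'
    obtain ⟨t, -, rfl⟩ := Finset.mem_image.1 hs'
    exact ((mem_incSets.1 hs).1.1 _ (Finset.mem_insert_self _ _)).ne rfl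

lemma occ_inv (k : ℕ) (p : SegPerm) : occ k p.inv = occ k p := by
  have key : ∀ (p : SegPerm) (s : Finset ℕ), s ∈ incSets k p →
      s.image p.perm ∈ incSets k p.inv := by
    intro p s hs
    rw [mem_incSets] at hs ⊢
    obtain ⟨⟨h1, h2⟩, h3⟩ := hs
    refine ⟨⟨fun x hx => ?_, ?_⟩, ?_⟩
    · obtain ⟨y, hy, rfl⟩ := Finset.mem_image.1 hx
      exact (p.lt_iff y).2 (h1 y hy)
    · rw [Finset.card_image_of_injective _ p.perm.injective, h2]
    · intro x hx y hy hxy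
      obtain ⟨x, hx', rfl⟩ := Finset.mem_image.1 hx
      obtain ⟨y, hy', rfl⟩ := Finset.mem_image.1 hy
      simpa using (h3.lt_iff_lt hx' hy').1 hxy
  refine (Finset.card_nbij' (fun s => s.image p.perm) (fun s => s.image p.inv.perm)
    (fun s hs => key p s hs) (fun s hs => by simpa using key p.inv s hs) (fun s _ => ?_) fun s _ => ?_).symm
  · simp [Finset.image_image, Function.comp_def]
  · simp [Finset.image_image, Function.comp_def]

/-- An increasing subsequence cannot meet both blocks. The length is `k + 1` because the empty
subsequence would be counted twice. -/
lemma occ_skew (k : ℕ) (p q : SegPerm) :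
    occ (k + 1) (skew p q) = occ (k + 1) p + occ (k + 1) q := by
  have hinj : Function.Injective (p.size + ·) := fun x y h => by simpa using h
  have h : incSets (k + 1) (skew p q) =
      incSets (k + 1) p ∪ (incSets (k + 1) q).image (Finset.image (p.size + ·)) := by
    ext s
    rw [Finset.mem_union, Finset.mem_image]
    constructor
    · rw [mem_incSets]
      rintro ⟨⟨h1, h2⟩, h3⟩
      by_cases hs : ∀ x ∈ s, x < p.size
      · left
        refine mem_incSets.2 ⟨⟨hs, h2⟩, fun x hx y hy hxy => ?_⟩
        have := h3 hx hy hxy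
        rwa [skew_left _ _ (hs x hx), skew_left _ _ (hs y hy), add_lt_add_iff_left] at this
      · right
        push Not at hs
        obtain ⟨z, hz, hzp⟩ := hs
        have hs : ∀ x ∈ s, p.size ≤ x := by
          intro x hx
          by_contra hc
          have h4 := h3 hx hz (by omega)
          have := skew_left_lt_right p q (not_le.1 hc) hzp (h1 z hz)
          omega
        have himg : Finset.image (p.size + ·) (s.image (· - p.size)) = s := by
          rw [Finset.image_image]
          refine (Finset.image_congr fun x hx => ?_).trans Finset.image_id
          simpa using Nat.add_sub_cancel' (hs x hx)
        refine ⟨s.image (· - p.size), mem_incSets.2 ⟨⟨fun x hx => ?_, ?_⟩, ?_⟩, himg⟩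
        · obtain ⟨y, hy, rfl⟩ := Finset.mem_image.1 hx
          have := h1 y hy
          have := hs y hy
          simp only [skew_size] at *
          omega
        · rw [← h2, ← himg, Finset.card_image_of_injective _ hinj, himg]
        · intro x hx y hy hxy
          obtain ⟨x, hx', rfl⟩ := Finset.mem_image.1 hx
          obtain ⟨y, hy', rfl⟩ := Finset.mem_image.1 hy
          have := h3 hx' hy' (by omega)
          rwa [skew_right' _ _ (hs x hx') (h1 x hx'),
            skew_right' _ _ (hs y hy') (h1 y hy')] at this
    · rintro (hs | ⟨t, ht, rfl⟩)
      · obtain ⟨⟨h1, h2⟩, h3⟩ := mem_incSets.1 hs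
        refine mem_incSets.2 ⟨⟨fun x hx => ?_, h2⟩, fun x hx y hy hxy => ?_⟩
        · have := h1 x hx
          simp; omega
        · rw [skew_left _ _ (h1 x hx), skew_left _ _ (h1 y hy), add_lt_add_iff_left]
          exact h3 hx hy hxy
      · obtain ⟨⟨h1, h2⟩, h3⟩ := mem_incSets.1 ht
        refine mem_incSets.2 ⟨⟨fun x hx => ?_, ?_⟩, fun x hx y hy hxy => ?_⟩
        · obtain ⟨y, hy, rfl⟩ := Finset.mem_image.1 hx
          simpa using h1 y hy
        · rw [Finset.card_image_of_injective _ hinj, h2]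
        · obtain ⟨x, hx', rfl⟩ := Finset.mem_image.1 hx
          obtain ⟨y, hy', rfl⟩ := Finset.mem_image.1 hy
          rw [skew_right _ _ (h1 x hx'), skew_right _ _ (h1 y hy')]
          exact h3 hx' hy' (by simpa using hxy)
  rw [occ, h, Finset.card_union_of_disjoint,
    Finset.card_image_of_injective _ (Finset.image_injective hinj), occ, occ]
  rw [Finset.disjoint_left]
  intro s hs hs'
  obtain ⟨t, ht, rfl⟩ := Finset.mem_image.1 hs'
  obtain ⟨x, hx⟩ := Finset.card_pos.1 ((Nat.succ_pos k).trans_eq (mem_incSets.1 ht).1.2.symm)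
  have := (mem_incSets.1 hs).1.1 _ (Finset.mem_image_of_mem _ hx)
  omega

lemma occ_wrap (k : ℕ) (p q : SegPerm) :
    occ (k + 1) (wrap p q) = 2 * (occ (k + 1) p + occ k p) + occ (k + 1) q := by
  rw [wrap, occ_skew, occ_skew, occ_snoc, occ_snoc, occ_inv, occ_inv]
  ring

/-- Deleting any one of the `k + 1` entries of an occurrence leaves an occurrence of 12...k. -/
lemma le_occ_of_occ_succ_ne_zero {k : ℕ} {p : SegPerm} (h : occ (k + 1) p ≠ 0) :
    k + 1 ≤ occ k p := by
  obtain ⟨s, hs⟩ := Finset.card_ne_zero.1 h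
  obtain ⟨⟨h1, h2⟩, h3⟩ := mem_incSets.1 hs
  have : (s.powersetCard k).card ≤ occ k p := by
    refine Finset.card_le_card fun t ht => ?_
    rw [Finset.mem_powersetCard] at ht
    exact mem_incSets.2 ⟨⟨fun x hx => h1 x (ht.1 hx), ht.2⟩, h3.mono (by exact_mod_cast ht.1)⟩
  rwa [Finset.card_powersetCard, h2, Nat.choose_succ_self_right] at this

end SegPerm

/-! ### Weighted generating functions -/

/-- The generating function of the set `S` by `size`, with weights `w`. -/
noncomputable def weightedGF {A : Type*} (S : Set A) (size : A → ℕ) (w : A → ℚ) : ℚ⟦X⟧ :=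
  PowerSeries.mk fun n => ∑ᶠ a ∈ {a ∈ S | size a = n}, w a

section weightedGF

variable {A B : Type*}

lemma weightedGF_congr {S : Set A} {size size' : A → ℕ} {w w' : A → ℚ}
    (hs : ∀ a ∈ S, size a = size' a) (hw : ∀ a ∈ S, w a = w' a) :
    weightedGF S size w = weightedGF S size' w' := by
  ext n
  rw [weightedGF, weightedGF, PowerSeries.coeff_mk, PowerSeries.coeff_mk]
  refine finsum_mem_congr (Set.ext fun a => ?_) fun a ha => hw a ha.1
  exact and_congr_right fun h => by rw [hs a h]

lemma weightedGF_image {f : A → B} {S : Set A} (hf : Set.InjOn f S) (size : B → ℕ) (w : B → ℚ) :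
    weightedGF (f '' S) size w = weightedGF S (size ∘ f) (w ∘ f) := by
  ext n
  rw [weightedGF, weightedGF, PowerSeries.coeff_mk, PowerSeries.coeff_mk,
    show {b ∈ f '' S | size b = n} = f '' {a ∈ S | (size ∘ f) a = n} by ext; aesop,
    finsum_mem_image (hf.mono fun a h => h.1)]
  rfl

/-- Finiteness of the size classes is needed because `finsum` takes the value 0 on infinite
supports. -/
lemma weightedGF_union {S T : Set A} (hST : Disjoint S T) {size : A → ℕ}
    (hfin : ∀ n, {a | size a = n}.Finite) (w : A → ℚ) :
    weightedGF (S ∪ T) size w = weightedGF S size w + weightedGF T size w := by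
  ext n
  rw [map_add, weightedGF, weightedGF, weightedGF, PowerSeries.coeff_mk, PowerSeries.coeff_mk,
    PowerSeries.coeff_mk, ← finsum_mem_union _ ((hfin n).subset fun a h => h.2)
      ((hfin n).subset fun a h => h.2)]
  · rw [show {a ∈ S ∪ T | size a = n} = {a ∈ S | size a = n} ∪ {a ∈ T | size a = n} by
      ext; simp only [Set.mem_union, Set.mem_ofPred_eq]; tauto]
  · exact hST.mono (fun a h => h.1) fun a h => h.1

lemma weightedGF_singleton (a : A) (size : A → ℕ) (w : A → ℚ) :
    weightedGF {a} size w = PowerSeries.monomial (size a) (w a) := by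
  ext n
  rw [weightedGF, PowerSeries.coeff_mk, PowerSeries.coeff_monomial]
  split_ifs with h
  · rw [show {b ∈ ({a} : Set A) | size b = n} = {a} by ext; aesop, finsum_mem_singleton]
  · rw [show {b ∈ ({a} : Set A) | size b = n} = ∅ by ext; aesop, finsum_mem_empty]

lemma weightedGF_prod (S : Set A) (T : Set B) {s : A → ℕ} {t : B → ℕ}
    (hs : ∀ n, {a | s a = n}.Finite) (ht : ∀ n, {b | t b = n}.Finite) (w : A → ℚ) (v : B → ℚ) :
    weightedGF (S ×ˢ T) (fun x => s x.1 + t x.2) (fun x => w x.1 * v x.2) =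
      weightedGF S s w * weightedGF T t v := by
  classical
  ext n
  have hS : ∀ n, {a ∈ S | s a = n}.Finite := fun n => (hs n).subset fun a h => h.2
  have hT : ∀ n, {b ∈ T | t b = n}.Finite := fun n => (ht n).subset fun b h => h.2
  rw [PowerSeries.coeff_mul]
  simp only [weightedGF, PowerSeries.coeff_mk]
  have h1 : {x ∈ S ×ˢ T | s x.1 + t x.2 = n} = (((Finset.HasAntidiagonal.antidiagonal n).biUnion fun ij =>
      (hS ij.1).toFinset ×ˢ (hT ij.2).toFinset : Finset (A × B)) : Set (A × B)) := by
    ext ⟨a, b⟩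
    simp
    tauto
  rw [h1, finsum_mem_coe_finset, Finset.sum_biUnion]
  · refine Finset.sum_congr rfl fun ij _ => ?_
    rw [Finset.sum_product, finsum_mem_eq_finite_toFinset_sum _ (hS ij.1),
      finsum_mem_eq_finite_toFinset_sum _ (hT ij.2), Finset.sum_mul_sum]
  · intro x _ y _ hxy
    rw [Function.onFun, Finset.disjoint_left]
    rintro ⟨a, b⟩ h h'
    simp at h h'
    exact hxy (Prod.ext (h.1.2.symm.trans h'.1.2) (h.2.2.symm.trans h'.2.2))

lemma finite_add_eq {s : A → ℕ} {t : B → ℕ} (hs : ∀ n, {a | s a = n}.Finite)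
    (ht : ∀ n, {b | t b = n}.Finite) (n : ℕ) : {x : A × B | s x.1 + t x.2 = n}.Finite := by
  refine ((Set.finite_le_nat n).biUnion fun i _ => (hs i).prod
    ((Set.finite_le_nat n).biUnion fun j _ => ht j)).subset ?_
  rintro ⟨a, b⟩ h
  simp only [Set.mem_ofPred_eq] at h
  simp only [Set.mem_iUnion, Set.mem_prod, Set.mem_ofPred_eq]
  exact ⟨s a, by omega, rfl, t b, by omega, rfl⟩

lemma weightedGF_shift (S : Set A) {s : A → ℕ} (hs : ∀ n, {a | s a = n}.Finite) (w : A → ℚ)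
    (c : ℕ) (r : ℚ) :
    weightedGF S (fun a => c + s a) (fun a => r * w a) =
      PowerSeries.monomial c r * weightedGF S s w := by
  -- The monomial is the generating function of a one-point set, so the shift is a case of the
  -- product rule.
  have hinj : Function.Injective (Prod.mk () : A → Unit × A) := Prod.mk_right_injective ()
  rw [← weightedGF_singleton () (fun _ => c) (fun _ => r),
    ← weightedGF_prod _ _ (fun n => Set.toFinite _) hs, Set.singleton_prod,
    weightedGF_image hinj.injOn]
  rfl

end weightedGF

/-! ### Transfer from permutations of `Fin n` to `SegPerm` -/

namespace SegPerm

/-- The embedding of the permutations of `Fin n`. -/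
def ofFin {n : ℕ} (π : Equiv.Perm (Fin n)) : SegPerm where
  size := n
  perm := π.extendDomain Fin.equivSubtype
  fix := fun _ hx => Equiv.Perm.extendDomain_apply_not_subtype _ _ (not_lt.2 hx)

@[simp] lemma ofFin_size {n : ℕ} (π : Equiv.Perm (Fin n)) : (ofFin π).size = n := rfl

@[simp] lemma ofFin_perm {n : ℕ} (π : Equiv.Perm (Fin n)) (x : Fin n) :
    (ofFin π).perm x = π x :=
  Equiv.Perm.extendDomain_apply_image π Fin.equivSubtype x

lemma ofFin_injective (n : ℕ) : Function.Injective (ofFin : Equiv.Perm (Fin n) → SegPerm) := by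
  intro π σ h
  refine Equiv.ext fun x => Fin.ext ?_
  rw [← ofFin_perm, h, ofFin_perm]

lemma exists_ofFin (p : SegPerm) : ∃ π : Equiv.Perm (Fin p.size), ofFin π = p := by
  refine ⟨⟨fun x => ⟨p.perm x, (p.lt_iff x).2 x.2⟩,
    fun x => ⟨p.perm.symm x, (p.inv.lt_iff x).2 x.2⟩, fun x => by simp, fun x => by simp⟩,
    ext_of_lt rfl fun x hx => ?_⟩
  exact ofFin_perm _ ⟨x, hx⟩

lemma ofFin_inv {n : ℕ} (π : Equiv.Perm (Fin n)) : ofFin π⁻¹ = (ofFin π).inv := by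
  refine ext_of_lt rfl fun x hx => ?_
  rw [inv_perm, eq_comm, Equiv.symm_apply_eq, ofFin_perm π⁻¹ ⟨x, hx⟩, ofFin_perm]
  simp

lemma finite_size_eq (n : ℕ) : {p : SegPerm | p.size = n}.Finite := by
  refine (Set.finite_range (ofFin : Equiv.Perm (Fin n) → SegPerm)).subset ?_
  rintro p rfl
  exact p.exists_ofFin

lemma invNum_ofFin {n : ℕ} (π : Equiv.Perm (Fin n)) :
    (ofFin π).invNum = inversionCount π := by
  classical
  rw [inversionCount, Set.ncard_eq_toFinset_card', Set.toFinset_ofPred, Finset.card_filter,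
    Fintype.sum_prod_type, invNum, ofFin_size, Finset.sum_range]
  refine Finset.sum_congr rfl fun x _ => ?_
  rw [Finset.sum_range]
  refine Finset.sum_congr rfl fun y _ => ?_
  simp

lemma av132_ofFin {n : ℕ} (π : Equiv.Perm (Fin n)) :
    (ofFin π).Av132 ↔ Avoids π pattern132 := by
  rw [Avoids, Set.eq_empty_iff_forall_notMem]
  constructor
  · intro h i hi
    refine h (i 0) (i 1) (i 2) (i.strictMono (by decide)) (i.strictMono (by decide))
      (i 2).2 ?_ ?_
    · rw [ofFin_perm, ofFin_perm]
      exact (hi 0 2).2 (by decide)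
    · rw [ofFin_perm, ofFin_perm]
      exact (hi 2 1).2 (by decide)
  · intro h x y z hx hy hz h1 h2
    lift z to Fin n using hz
    lift y to Fin n using hy.trans z.2
    lift x to Fin n using hx.trans y.2
    rw [ofFin_perm, ofFin_perm] at h1 h2
    rw [Fin.val_fin_lt] at hx hy h1 h2
    refine h (OrderEmbedding.ofStrictMono ![x, y, z] ?_) ?_
    · intro a b hab
      fin_cases a <;> fin_cases b <;> simp_all
      exact hx.trans hy
    · intro a b
      have h3 := h1.trans h2
      have e0 : pattern132 0 = 0 := by decide
      have e1 : pattern132 1 = 2 := by decide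
      have e2 : pattern132 2 = 1 := by decide
      change π (![x, y, z] a) < π (![x, y, z] b) ↔ _
      fin_cases a <;> fin_cases b <;> simp [e0, e1, e2, h1, h2, h3, h1.le, h2.le, h3.le]

/-- An order embedding is determined by its range, so occurrences correspond to `k`-sets of
positions on which `π` increases. -/
lemma occ_ofFin (k : ℕ) {n : ℕ} (π : Equiv.Perm (Fin n)) :
    occ k (ofFin π) = (patternOccurrences (increasingPattern k) π).ncard := by
  classical
  have hmem : ∀ i, i ∈ patternOccurrences (increasingPattern k) π ↔
      ∀ a b, π (i a) < π (i b) ↔ a < b := fun i => Iff.rfl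
  rw [Set.ncard_eq_toFinset_card', occ, eq_comm]
  refine Finset.card_bij (fun i _ => Finset.univ.image fun a => (i a : ℕ)) ?_ ?_ ?_
  · intro i hi
    rw [Set.mem_toFinset, hmem] at hi
    refine mem_incSets.2 ⟨⟨fun x hx => ?_, ?_⟩, fun x hx y hy hxy => ?_⟩
    · obtain ⟨a, -, rfl⟩ := Finset.mem_image.1 hx
      exact (i a).2
    · rw [Finset.card_image_of_injective _ fun a b h => i.injective (Fin.ext h), Finset.card_univ,
        Fintype.card_fin]
    · obtain ⟨a, -, rfl⟩ := Finset.mem_image.1 hx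
      obtain ⟨b, -, rfl⟩ := Finset.mem_image.1 hy
      rw [ofFin_perm, ofFin_perm, Fin.val_fin_lt, hi]
      exact i.lt_iff_lt.1 hxy
  · intro i _ j _ hij
    have : Set.range i = Set.range j := by
      refine Set.image_injective.2 Fin.val_injective ?_
      simpa [← Set.range_comp, Function.comp_def] using
        congrArg (fun s : Finset ℕ => (s : Set ℕ)) hij
    exact DFunLike.coe_injective ((StrictMono.range_inj i.strictMono j.strictMono).1 this)
  · intro s hs
    obtain ⟨⟨h1, h2⟩, h3⟩ := mem_incSets.1 hs
    have h4 : ∀ a, s.orderEmbOfFin h2 a < n := fun a => h1 _ (s.orderEmbOfFin_mem h2 a)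
    refine ⟨OrderEmbedding.ofStrictMono (fun a => ⟨s.orderEmbOfFin h2 a, h4 a⟩)
      fun a b hab => (s.orderEmbOfFin h2).strictMono hab, ?_, ?_⟩
    · rw [Set.mem_toFinset, hmem]
      intro a b
      rw [← Fin.val_fin_lt, ← ofFin_perm, ← ofFin_perm]
      change (ofFin π).perm (s.orderEmbOfFin h2 a) < (ofFin π).perm (s.orderEmbOfFin h2 b) ↔ _
      rw [h3.lt_iff_lt (s.orderEmbOfFin_mem h2 a) (s.orderEmbOfFin_mem h2 b),
        OrderEmbedding.lt_iff_lt]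
    · exact Finset.image_orderEmbOfFin_univ s h2

/-! ### The recursions -/

/-- The `132`-avoiding permutations that avoid `12...k`. -/
def avoiders (k : ℕ) : Set SegPerm := {p | p.Av132 ∧ occ k p = 0}

/-- The `132`-avoiding involutions that contain `12...k` exactly once. -/
def involutionsOnce (k : ℕ) : Set SegPerm := {p | p.Av132 ∧ p.inv = p ∧ occ k p = 1}

lemma occ_succ_eq_zero {k : ℕ} {p : SegPerm} (h : occ k p = 0) : occ (k + 1) p = 0 := by
  by_contra hc
  have := le_occ_of_occ_succ_ne_zero hc
  omega

lemma occ_succ_eq_zero_of_occ_eq_one {k : ℕ} (hk : 1 ≤ k) {p : SegPerm} (h : occ k p = 1) :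
    occ (k + 1) p = 0 := by
  by_contra hc
  have := le_occ_of_occ_succ_ne_zero hc
  omega

lemma avoiders_zero : avoiders 0 = ∅ := by
  ext p
  simp [avoiders, occ_zero]

/-- Splitting at the maximum, `skew q.snoc r` has `occ (k + 1) q + occ k q + occ (k + 1) r`
occurrences, and `occ k q = 0` already forces the first term to vanish. -/
lemma avoiders_succ (k : ℕ) : avoiders (k + 1) =
    {empty} ∪ (fun x : SegPerm × SegPerm => skew x.1.snoc x.2) ''
      (avoiders k ×ˢ avoiders (k + 1)) := by
  ext p
  constructor
  · rintro ⟨h1, h2⟩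
    by_cases hs : p.size = 0
    · exact Or.inl (ext_of_lt hs fun x hx => by omega)
    · obtain ⟨q, r, rfl⟩ := h1.exists_skew_snoc hs
      rw [av132_skew, av132_snoc] at h1
      rw [occ_skew, occ_snoc] at h2
      exact Or.inr ⟨(q, r), ⟨⟨h1.1, by dsimp only; omega⟩, ⟨h1.2, by dsimp only; omega⟩⟩, rfl⟩
  · rintro (rfl | ⟨⟨q, r⟩, ⟨⟨h1, h2⟩, ⟨h3, h4⟩⟩, rfl⟩)
    · exact ⟨av132_empty, occ_empty k⟩
    · dsimp only at *
      refine ⟨(av132_skew _ _).2 ⟨(av132_snoc _).2 h1, h3⟩, ?_⟩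
      rw [occ_skew, occ_snoc, h2, h4, occ_succ_eq_zero h2]

lemma involutionsOnce_one : involutionsOnce 1 = {empty.snoc} := by
  ext p
  rw [Set.mem_singleton_iff, involutionsOnce, Set.mem_ofPred_eq, occ_one]
  constructor
  · rintro ⟨-, -, h⟩
    refine ext_of_lt h fun x hx => ?_
    have h1 := (p.lt_iff x).2 hx
    simp only [empty, snoc_perm, Equiv.Perm.coe_one, id_eq]
    omega
  · rintro rfl
    exact ⟨(av132_snoc _).2 av132_empty, rfl, rfl⟩

lemma av132_wrap (p q : SegPerm) : (wrap p q).Av132 ↔ p.Av132 ∧ q.Av132 := by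
  rw [wrap, av132_skew, av132_skew, av132_snoc, av132_snoc]
  exact ⟨fun h => ⟨h.1, h.2.1⟩, fun h => ⟨h.1, h.2, av132_inv h.1⟩⟩

/-- In `q.snoc`, an occurrence of 12...(k+1) within `q` would bring at least `k + 1` further ones
ending at the new maximum, so the single one uses that maximum. In `wrap p q` the contribution of
`p` is even, hence zero. -/
lemma involutionsOnce_succ {k : ℕ} (hk : 1 ≤ k) : involutionsOnce (k + 1) =
    snoc '' involutionsOnce k ∪ (fun x : SegPerm × SegPerm => wrap x.1 x.2) ''
      (avoiders k ×ˢ involutionsOnce (k + 1)) := by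
  ext p
  constructor
  · rintro ⟨h1, h2, h3⟩
    have hs : p.size ≠ 0 := fun hs => by
      rw [show p = empty from ext_of_lt hs fun x hx => by omega, occ_empty] at h3
      exact one_ne_zero h3.symm
    rcases h1.exists_snoc_or_wrap hs h2 with ⟨q, rfl⟩ | ⟨q, r, rfl⟩
    · refine Or.inl ⟨q, ⟨(av132_snoc _).1 h1, (snoc_involutive_iff _).1 h2, ?_⟩, rfl⟩
      rw [occ_snoc] at h3
      by_cases hc : occ (k + 1) q = 0
      · omega
      · have := le_occ_of_occ_succ_ne_zero hc
        omega
    · rw [av132_wrap] at h1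
      rw [wrap_involutive_iff] at h2
      rw [occ_wrap] at h3
      exact Or.inr ⟨(q, r), ⟨⟨h1.1, by dsimp only; omega⟩, ⟨h1.2, h2, by dsimp only; omega⟩⟩, rfl⟩
  · rintro (⟨q, ⟨h1, h2, h3⟩, rfl⟩ | ⟨⟨q, r⟩, ⟨⟨h1, h2⟩, ⟨h3, h4, h5⟩⟩, rfl⟩)
    · refine ⟨(av132_snoc _).2 h1, (snoc_involutive_iff _).2 h2, ?_⟩
      rw [occ_snoc, h3, occ_succ_eq_zero_of_occ_eq_one hk h3]
    · dsimp only at *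
      refine ⟨(av132_wrap _ _).2 ⟨h1, h3⟩, (wrap_involutive_iff _ _).2 h4, ?_⟩
      rw [occ_wrap, h2, h5, occ_succ_eq_zero h2]

/-- The series `∑ ε ^ |p| * x ^ (2 * |p|)` over the `132`- and `12...k`-avoiding `p`. -/
noncomputable def avoidersGF (ε : ℚ) (k : ℕ) : ℚ⟦X⟧ :=
  weightedGF (avoiders k) (fun p => 2 * p.size) fun p => ε ^ p.size

/-- The series `∑ ε ^ (inversions of p) * x ^ |p|` over the `132`-avoiding involutions `p` that
contain `12...k` exactly once. -/
noncomputable def involutionsOnceGF (ε : ℚ) (k : ℕ) : ℚ⟦X⟧ :=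
  weightedGF (involutionsOnce k) size fun p => ε ^ p.invNum

lemma finite_two_mul_size_eq (n : ℕ) : {p : SegPerm | 2 * p.size = n}.Finite :=
  (finite_size_eq (n / 2)).subset fun p (hp : 2 * p.size = n) => by
    rw [Set.mem_ofPred_eq]; omega

lemma avoidersGF_zero (ε : ℚ) : avoidersGF ε 0 = 0 := by
  ext n
  simp [avoidersGF, avoiders_zero, weightedGF]

lemma monomial_eq (n : ℕ) (r : ℚ) :
    PowerSeries.monomial n r = PowerSeries.C r * (PowerSeries.X : ℚ⟦X⟧) ^ n := by
  ext m
  rw [PowerSeries.coeff_monomial, PowerSeries.coeff_C_mul, PowerSeries.coeff_X_pow, mul_ite,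
    mul_one, mul_zero]

lemma avoidersGF_succ (ε : ℚ) (k : ℕ) : avoidersGF ε (k + 1) =
    1 + PowerSeries.C ε * PowerSeries.X ^ 2 * avoidersGF ε k * avoidersGF ε (k + 1) := by
  conv_lhs => rw [avoidersGF, avoiders_succ]
  rw [weightedGF_union _ finite_two_mul_size_eq, weightedGF_singleton, weightedGF_image]
  · congr 1
    · simp [empty, monomial_eq]
    rw [mul_assoc, avoidersGF, avoidersGF, ← weightedGF_prod _ _ finite_two_mul_size_eq
      finite_two_mul_size_eq, ← monomial_eq, ← weightedGF_shift]
    · refine weightedGF_congr (fun x _ => ?_) fun x _ => ?_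
      · simp; ring
      · simp; ring
    · exact finite_add_eq finite_two_mul_size_eq finite_two_mul_size_eq
  · rintro ⟨p, q⟩ - ⟨p', q'⟩ - h
    exact Prod.ext (skew_snoc_inj h).1 (skew_snoc_inj h).2
  · rw [Set.disjoint_singleton_left]
    rintro ⟨⟨p, q⟩, -, h⟩
    have := congrArg size h
    simp [empty] at this

lemma involutionsOnceGF_one (ε : ℚ) : involutionsOnceGF ε 1 = PowerSeries.X := by
  rw [involutionsOnceGF, involutionsOnce_one, weightedGF_singleton, invNum_snoc, monomial_eq]
  simp [empty, invNum]

lemma involutionsOnceGF_succ {ε : ℚ} (hε : ε ^ 2 = 1) {k : ℕ} (hk : 1 ≤ k) :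
    involutionsOnceGF ε (k + 1) = PowerSeries.X * involutionsOnceGF ε k +
      PowerSeries.C ε * PowerSeries.X ^ 2 * avoidersGF ε k * involutionsOnceGF ε (k + 1) := by
  conv_lhs => rw [involutionsOnceGF, involutionsOnce_succ hk]
  rw [weightedGF_union _ finite_size_eq, weightedGF_image snoc_injective.injOn,
    weightedGF_image]
  · congr 1
    · rw [← one_mul (PowerSeries.X * _), ← mul_assoc, ← map_one PowerSeries.C,
        ← pow_one PowerSeries.X, ← monomial_eq, involutionsOnceGF,
        ← weightedGF_shift _ finite_size_eq]
      refine weightedGF_congr (fun x _ => ?_) fun x _ => ?_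
      · simp; ring
      · simp [invNum_snoc]
    · rw [mul_assoc, avoidersGF, involutionsOnceGF, ← weightedGF_prod _ _ finite_two_mul_size_eq
        finite_size_eq, ← monomial_eq, ← weightedGF_shift]
      · refine weightedGF_congr (fun x _ => ?_) fun x _ => ?_
        · simp [wrap_size]; ring
        · simp [pow_invNum_wrap hε]; ring
      · exact finite_add_eq finite_two_mul_size_eq finite_size_eq
  · rintro ⟨p, q⟩ - ⟨p', q'⟩ - h
    exact Prod.ext (wrap_inj h).1 (wrap_inj h).2
  · rw [Set.disjoint_left]
    rintro _ ⟨r, -, rfl⟩ ⟨⟨p, q⟩, -, h⟩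
    exact wrap_ne_snoc p q r h

end SegPerm

-- `(1 + (-1) ^ m) / 2` is the indicator of even `m`.
open SegPerm in
lemma evenInvolutionsGF_eq (k : ℕ) : evenInvolutionsGF (increasingPattern k) 1 =
    PowerSeries.C (1 / 2) * (involutionsOnceGF 1 k + involutionsOnceGF (-1) k) := by
  ext n
  rw [PowerSeries.coeff_C_mul, map_add]
  simp only [involutionsOnceGF, weightedGF, evenInvolutionsGF, PowerSeries.coeff_mk, one_pow]
  have hfin : {p ∈ involutionsOnce k | p.size = n}.Finite :=
    (finite_size_eq n).subset fun p h => h.2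
  rw [← finsum_mem_add_distrib hfin, finsum_mem_eq_finite_toFinset_sum _ hfin]
  have h1 : ofFin '' evenInvolutions (increasingPattern k) 1 n =
      {p ∈ involutionsOnce k | p.size = n ∧ Even p.invNum} := by
    ext p
    constructor
    · rintro ⟨π, ⟨h1, h2, h3, h4⟩, rfl⟩
      refine ⟨⟨(av132_ofFin π).2 h3, ?_, (occ_ofFin k π).trans h4⟩, rfl, ?_⟩
      · rw [← ofFin_inv, ← h1]
      · rwa [invNum_ofFin]
    · rintro ⟨⟨h1, h2, h3⟩, rfl, h4⟩
      obtain ⟨π, hπ⟩ := p.exists_ofFin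
      refine ⟨π, ⟨ofFin_injective _ ?_, ?_, ?_, ?_⟩, hπ⟩
      · rw [ofFin_inv, hπ, h2]
      · rwa [← invNum_ofFin, hπ]
      · rwa [← av132_ofFin, hπ]
      · rwa [ContainsExactly, ← occ_ofFin, hπ]
  have h2 : {p ∈ involutionsOnce k | p.size = n ∧ Even p.invNum} =
      ↑(hfin.toFinset.filter fun p => Even p.invNum) := by
    ext p
    simp [and_assoc]
  rw [← Set.ncard_image_of_injective _ (ofFin_injective n), h1, h2, Set.ncard_coe_finset,
    Finset.card_filter, Nat.cast_sum, Finset.mul_sum]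
  refine Finset.sum_congr rfl fun p _ => ?_
  split_ifs with h
  · rw [h.neg_one_pow]; norm_num
  · rw [(Nat.not_even_iff_odd.1 h).neg_one_pow]; norm_num

/-! ### The rational functions -/

lemma eval₂_C_algebraMap (q p : Polynomial ℚ) :
    Polynomial.eval₂RingHom (RatFunc.C : ℚ →+* RatFunc ℚ) (algebraMap _ _ q) p =
      algebraMap (Polynomial ℚ) (RatFunc ℚ) (p.comp q) := by
  rw [Polynomial.coe_eval₂RingHom, Polynomial.comp, Polynomial.hom_eval₂]
  rfl

/-- Substitution of a nonconstant polynomial as a homomorphism of fields. -/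
lemma exists_substHom (q : Polynomial ℚ) (hq : q.natDegree ≠ 0) :
    ∃ φ : RatFunc ℚ →+* RatFunc ℚ, (∀ f, φ f = ratSubst f (algebraMap _ _ q)) ∧
      ∀ p : Polynomial ℚ, φ (algebraMap _ _ p) = algebraMap _ _ (p.comp q) := by
  have hinj : Function.Injective
      (Polynomial.eval₂RingHom (RatFunc.C : ℚ →+* RatFunc ℚ) (algebraMap _ _ q)) := by
    rw [injective_iff_map_eq_zero]
    intro p hp
    rw [eval₂_C_algebraMap] at hp
    have h := (map_eq_zero_iff _ (RatFunc.algebraMap_injective ℚ)).1 hp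
    -- A composition `p.comp q` vanishes only if `p = 0` or `q` is constant.
    rcases Polynomial.comp_eq_zero_iff.1 h with h | ⟨-, h⟩
    · exact h
    · rw [h] at hq
      simp at hq
  refine ⟨RatFunc.liftRingHom _ (nonZeroDivisors_le_comap_nonZeroDivisors_of_injective _ hinj),
    fun f => ?_, fun p => ?_⟩
  · rw [RatFunc.liftRingHom_apply]; rfl
  · rw [← eval₂_C_algebraMap]
    exact RatFunc.liftRingHom_algebraMap _ _ _

lemma chebU_natCast_ne_zero (n : ℕ) : chebU n ≠ 0 := fun h => by
  have h1 := sqSubstHom_chebAux n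
  rw [h, mul_zero, map_eq_zero, map_eq_zero_iff _ (RatFunc.algebraMap_injective ℚ)] at h1
  exact chebAux_ne_zero n h1

lemma chebU_add_two (n : ℤ) :
    chebU (n + 2) = 1 / RatFunc.X * chebU (n + 1) - chebU n := by
  simp only [chebU, Polynomial.Chebyshev.U_add_two, map_sub, map_mul, map_ofNat,
    Polynomial.aeval_X]
  congr 2
  have := RatFunc.X_ne_zero (K := ℚ)
  field_simp

lemma chebR_zero : chebR 0 = 0 := by
  refine sqSubstHom.injective ?_
  rw [sqSubstHom_apply, chebR_spec, map_zero]
  simp [chebU]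

/-- This is the three-term Chebyshev recurrence divided by its middle term. Together with
`chebR_zero` it determines every `chebR k`. -/
lemma chebR_succ_mul (k : ℕ) : chebR (k + 1) * (1 - RatFunc.X * chebR k) = 1 := by
  have hx := RatFunc.X_ne_zero (K := ℚ)
  have h1 := chebU_natCast_ne_zero k
  have h2 := chebU_natCast_ne_zero (k + 1)
  have h3 := chebU_add_two ((k : ℤ) - 1)
  rw [show (k : ℤ) - 1 + 2 = ((k + 1 : ℕ) : ℤ) by push_cast; ring, sub_add_cancel] at h3
  refine sqSubstHom.injective ?_
  rw [map_mul, map_sub, map_mul, map_one, sqSubstHom_apply, sqSubstHom_apply, sqSubstHom_apply,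
    chebR_spec, chebR_spec, ratSubst, RatFunc.eval_X]
  rw [show ((k + 1 : ℕ) : ℤ) - 1 = k by push_cast; ring]
  rw [h3] at h2 ⊢
  generalize chebU ((k : ℤ) - 1) = a at *
  generalize chebU (k : ℤ) = b at *
  have h4 : b - RatFunc.X * a ≠ 0 := fun h => h2 (by
    rw [sub_eq_zero] at h
    rw [h]; field_simp; ring)
  field_simp

/-- `R_k(ε x²)`, in terms of which the recursions for `ε = ±1` agree. -/
noncomputable def signedR (ε : ℚ) (k : ℕ) : RatFunc ℚ :=
  ratSubst (chebR k) (RatFunc.C ε * RatFunc.X ^ 2)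

lemma signedR_zero (ε : ℚ) : signedR ε 0 = 0 := by
  simp [signedR, chebR_zero, ratSubst]

lemma signedR_succ_mul {ε : ℚ} (hε : ε ≠ 0) (k : ℕ) :
    signedR ε (k + 1) * (1 - RatFunc.C ε * RatFunc.X ^ 2 * signedR ε k) = 1 := by
  obtain ⟨φ, h1, h2⟩ := exists_substHom (Polynomial.C ε * Polynomial.X ^ 2)
    (by rw [Polynomial.natDegree_C_mul_X_pow _ _ hε]; norm_num)
  have h3 : algebraMap (Polynomial ℚ) (RatFunc ℚ) (Polynomial.C ε * Polynomial.X ^ 2) =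
      RatFunc.C ε * RatFunc.X ^ 2 := by simp
  rw [h3] at h1
  have h4 := congrArg φ (chebR_succ_mul k)
  have h5 := h2 Polynomial.X
  rw [Polynomial.X_comp, h3, RatFunc.algebraMap_X] at h5
  rwa [map_mul, map_sub, map_mul, map_one, h5, h1, h1] at h4

lemma ratSubst_chebREven (k : ℕ) : ratSubst (chebREven k) (RatFunc.X ^ 2) =
    (1 / 2) * (signedR 1 k + signedR (-1) k) := by
  obtain ⟨φ, h1, h2⟩ := exists_substHom (-Polynomial.X) (by simp)
  obtain ⟨ψ, h3, h4⟩ := exists_substHom (-Polynomial.X ^ 2) (by simp)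
  -- Substituting `-x` and then `x²` is substituting `-x²`; it suffices to check this on
  -- polynomials.
  have h5 : (sqSubstHom.comp φ) = ψ := by
    refine IsLocalization.ringHom_ext (nonZeroDivisors (Polynomial ℚ)) (RingHom.ext fun p => ?_)
    simp only [RingHom.comp_apply, h2, h4]
    rw [sqSubstHom_apply, ratSubst, RatFunc.eval_algebraMap, ← Polynomial.coe_eval₂RingHom,
      eval₂_sq, Polynomial.expand_eq_comp_X_pow, Algebra.algebraMap_self, RingHom.id_apply,
      Polynomial.comp_assoc]
    simp
  rw [← sqSubstHom_apply, chebREven, map_mul, map_add, map_div₀, map_one, map_ofNat, signedR,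
    signedR, sqSubstHom_apply]
  congr 2
  · simp
  · have h6 := h3 (chebR k)
    rw [← h5, RingHom.comp_apply, h1] at h6
    simpa using h6

lemma signedR_one (k : ℕ) :
    signedR 1 k = chebU ((k : ℤ) - 1) / (RatFunc.X * chebU k) := by
  rw [← chebR_spec, signedR, map_one, one_mul]

lemma signedR_neg_one (k : ℕ) : signedR (-1) k = ratSubst (chebR k) (-(RatFunc.X ^ 2)) := by
  rw [signedR, map_neg, map_one, neg_one_mul]

/-- The rational generating function with sign `ε`. -/
noncomputable def signedW (ε : ℚ) (k : ℕ) : RatFunc ℚ :=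
  RatFunc.X ^ k * ∏ i ∈ Finset.Icc 2 k, signedR ε i

lemma signedW_one_idx (ε : ℚ) : signedW ε 1 = RatFunc.X := by
  simp [signedW]

lemma signedW_succ (ε : ℚ) {k : ℕ} (hk : 1 ≤ k) :
    signedW ε (k + 1) = RatFunc.X * signedR ε (k + 1) * signedW ε k := by
  rw [signedW, signedW, Finset.prod_Icc_succ_top (by omega)]
  ring

/-- The factors `U_{i-1} / (x U_i)` telescope to `U_1 / (x ^ (k - 1) U_k)`, and `U_1(1/(2x)) = 1/x`.
-/
lemma signedW_one_mul_chebU {k : ℕ} (hk : 1 ≤ k) : signedW 1 k * chebU k = 1 := by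
  have hx := RatFunc.X_ne_zero (K := ℚ)
  induction k, hk using Nat.le_induction with
  | base =>
    simp only [signedW_one_idx, chebU, Nat.cast_one, Polynomial.Chebyshev.U_one, map_mul,
      map_ofNat, Polynomial.aeval_X]
    field_simp
  | succ k hk ih =>
    rw [signedW_succ _ hk, signedR_one]
    rw [show ((k + 1 : ℕ) : ℤ) - 1 = k by push_cast; ring]
    have := chebU_natCast_ne_zero (k + 1)
    rw [← ih]
    field_simp

/-- Passing from `k` to `k + 1` multiplies every old term on the right by `x R_{k+1}(-x²)`. On the
left, `W_k` for `ε = 1` is multiplied by `x R_{k+1}(x²)` instead, and the discrepancy is the new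
last summand. -/
lemma half_signedW_add {k : ℕ} (hk : 1 ≤ k) :
    (1 / 2) * (signedW 1 k + signedW (-1) k) =
      RatFunc.X ^ k * ∏ i ∈ Finset.Icc 2 k, ratSubst (chebR i) (-(RatFunc.X ^ 2)) +
        ∑ j ∈ Finset.range (k - 1),
          RatFunc.X ^ (k - j) * ratSubst (chebREven (j + 1)) (RatFunc.X ^ 2) *
            (∏ i ∈ Finset.Icc (j + 2) k, ratSubst (chebR i) (-(RatFunc.X ^ 2))) /
              chebU ((j : ℤ) + 2) := by
  have hx := RatFunc.X_ne_zero (K := ℚ)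
  simp only [← signedR_neg_one, ratSubst_chebREven]
  induction k, hk using Nat.le_induction with
  | base =>
    simp [signedW_one_idx]
    ring
  | succ k hk ih =>
    obtain ⟨m, rfl⟩ := Nat.exists_eq_add_of_le' hk
    have h1 : ∀ j ∈ Finset.range m,
        RatFunc.X ^ (m + 1 + 1 - j) * (1 / 2 * (signedR 1 (j + 1) + signedR (-1) (j + 1))) *
          (∏ i ∈ Finset.Icc (j + 2) (m + 1 + 1), signedR (-1) i) / chebU ((j : ℤ) + 2) =
        RatFunc.X * signedR (-1) (m + 1 + 1) * (RatFunc.X ^ (m + 1 - j) *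
          (1 / 2 * (signedR 1 (j + 1) + signedR (-1) (j + 1))) *
          (∏ i ∈ Finset.Icc (j + 2) (m + 1), signedR (-1) i) / chebU ((j : ℤ) + 2)) := by
      intro j hj
      rw [Finset.mem_range] at hj
      rw [Finset.prod_Icc_succ_top (by omega), show m + 1 + 1 - j = (m + 1 - j) + 1 by omega,
        pow_succ]
      ring
    rw [Nat.add_sub_cancel] at ih ⊢
    rw [Finset.sum_range_succ, Finset.sum_congr rfl h1, ← Finset.mul_sum,
      Finset.prod_Icc_succ_top (by omega), Finset.Icc_self, Finset.prod_singleton,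
      show m + 1 + 1 - m = 2 by omega]
    have h2 : (RatFunc.X ^ 2 * (1 / 2 * (signedR 1 (m + 1) + signedR (-1) (m + 1))) *
        signedR (-1) (m + 1 + 1) / chebU ((m : ℤ) + 2) : RatFunc ℚ) =
        RatFunc.X ^ 2 * (1 / 2 * (signedR 1 (m + 1) + signedR (-1) (m + 1))) *
        signedR (-1) (m + 1 + 1) * signedW 1 (m + 1 + 1) := by
      rw [div_eq_iff (by exact_mod_cast chebU_natCast_ne_zero (m + 2)),
        show ((m : ℤ) + 2) = ((m + 1 + 1 : ℕ) : ℤ) by push_cast; ring, mul_assoc _ (signedW _ _),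
        signedW_one_mul_chebU (by omega), mul_one]
    rw [h2]
    have h3 := signedR_succ_mul (ε := -1) (by norm_num) (m + 1)
    have h4 := signedR_succ_mul (ε := 1) (by norm_num) (m + 1)
    have h5 := signedW_succ (-1) hk
    have h6 := signedW_succ 1 hk
    rw [map_neg, map_one] at h3
    rw [map_one] at h4
    generalize signedR (-1) (m + 1 + 1) = a at *
    generalize signedR (-1) (m + 1) = b at *
    generalize signedR 1 (m + 1 + 1) = c at *
    generalize signedR 1 (m + 1) = d at *
    rw [h5, h6]
    rw [pow_succ (RatFunc.X) (m + 1)]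
    -- The combination `a * h4 - c * h3` says `c - a = x² a c (b + d)`.
    linear_combination RatFunc.X * a * ih +
      RatFunc.X * signedW 1 (m + 1) / 2 * (a * h4 - c * h3)

/-! ### Comparison of the two sides -/

open scoped RatFunc in
/-- The Laurent series expansion of a rational function. -/
noncomputable def ratToLaurent (F : Type*) [Field F] : RatFunc F →+* F⸨X⸩ :=
  algebraMap (RatFunc F) F⸨X⸩

open scoped RatFunc in
lemma ratToLaurent_C {F : Type*} [Field F] (r : F) : ratToLaurent F (RatFunc.C r) =
    HahnSeries.ofPowerSeries ℤ F (PowerSeries.C r) := by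
  rw [ratToLaurent, ← RatFunc.algebraMap_C,
    ← IsScalarTower.algebraMap_apply (Polynomial F) (RatFunc F) F⸨X⸩]
  simp

lemma ratToLaurent_X {F : Type*} [Field F] : ratToLaurent F RatFunc.X =
    HahnSeries.ofPowerSeries ℤ F PowerSeries.X := by
  rw [HahnSeries.ofPowerSeries_X]
  exact RatFunc.coe_X

/-- Both sides start at 0 and satisfy the same recursion, in which the next term is the inverse of
`1 - ε x²` times the current one. -/
lemma coe_avoidersGF {ε : ℚ} (hε : ε ≠ 0) (k : ℕ) :
    HahnSeries.ofPowerSeries ℤ ℚ (SegPerm.avoidersGF ε k) =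
      ratToLaurent ℚ (signedR ε k) := by
  induction k with
  | zero => rw [SegPerm.avoidersGF_zero, signedR_zero, map_zero, map_zero]
  | succ k ih =>
    have h1 := congrArg (HahnSeries.ofPowerSeries ℤ ℚ) (SegPerm.avoidersGF_succ ε k)
    have h2 := congrArg (ratToLaurent ℚ) (signedR_succ_mul hε k)
    simp only [map_add, map_sub, map_mul, map_pow, map_one, ratToLaurent_C,
      ratToLaurent_X] at h1 h2
    rw [ih] at h1
    linear_combination ratToLaurent ℚ (signedR ε (k + 1)) * h1 -
      HahnSeries.ofPowerSeries ℤ ℚ (SegPerm.avoidersGF ε (k + 1)) * h2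

lemma coe_involutionsOnceGF {ε : ℚ} (hε : ε ^ 2 = 1) {k : ℕ} (hk : 1 ≤ k) :
    HahnSeries.ofPowerSeries ℤ ℚ (SegPerm.involutionsOnceGF ε k) =
      ratToLaurent ℚ (signedW ε k) := by
  have hε' : ε ≠ 0 := by
    rintro rfl
    norm_num at hε
  induction k, hk using Nat.le_induction with
  | base => rw [SegPerm.involutionsOnceGF_one, signedW_one_idx, ratToLaurent_X]
  | succ k hk ih =>
    have h1 := congrArg (HahnSeries.ofPowerSeries ℤ ℚ) (SegPerm.involutionsOnceGF_succ hε hk)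
    have h2 := congrArg (ratToLaurent ℚ) (signedR_succ_mul hε' k)
    rw [signedW_succ ε hk]
    simp only [map_add, map_sub, map_mul, map_pow, map_one, ratToLaurent_C,
      ratToLaurent_X] at h1 h2 ⊢
    rw [ih, coe_avoidersGF hε'] at h1
    -- By `h2`, multiplying by `R_{k+1}(ε x²)` inverts the factor `1 - ε x² R_k(ε x²)` in `h1`.
    linear_combination ratToLaurent ℚ (signedR ε (k + 1)) * h1 -
      HahnSeries.ofPowerSeries ℤ ℚ (SegPerm.involutionsOnceGF ε (k + 1)) * h2

theorem mainTheorem8 (k : ℕ) (hk : 2 ≤ k) :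
    ((evenInvolutionsGF (increasingPattern k) 1 : ℚ⟦X⟧) : ℚ⸨X⸩) =
      ((RatFunc.X ^ k * ∏ i ∈ Finset.Icc 2 k, ratSubst (chebR i) (-(RatFunc.X ^ 2)) +
        ∑ j ∈ Finset.range (k - 1),
          RatFunc.X ^ (k - j) * ratSubst (chebREven (j + 1)) (RatFunc.X ^ 2) *
            (∏ i ∈ Finset.Icc (j + 2) k, ratSubst (chebR i) (-(RatFunc.X ^ 2))) /
              chebU ((j : ℤ) + 2) : RatFunc ℚ) : ℚ⸨X⸩) := by
  have hk1 : 1 ≤ k := by omega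
  rw [← half_signedW_add hk1, evenInvolutionsGF_eq]
  change _ = ratToLaurent ℚ _
  rw [map_mul, map_add, map_mul, map_add, coe_involutionsOnceGF (by norm_num) hk1,
    coe_involutionsOnceGF (by norm_num) hk1, ← ratToLaurent_C, map_div₀, map_one, map_ofNat]
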